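/- Let $X$ be a finite alphabet with at least two symbols. A *monotone (Turing) machine* $T$ maps each finite binary string $p$ to a finite or infinite string $T(p)$ over $X$, such that $T(p)$ is a prefix of $T(q)$ whenever $p$ is a prefix of $q$, and such that the set of pairs $(p,x)$ of finite strings with $x \sqsubseteq T(p)$ ($x$ is a prefix of $T(p)$) is recursively enumerable. A monotone machine $U$ is *universal* if for every monotone machine $T$ there is a finite binary string $w$ with $U(wp) = T(p)$ for all finite binary strings $p$. For a finite string $x$ over $X$ let $$M_U(x) := \sum_{p} 2^{-|p|},$$ where the sum is over the minimal programs for $x$, i.e. over all finite binary strings $p$ with $x \sqsubseteq U(p)$ such that $x \not\sqsubseteq U(q)$ for all proper prefixes $q$ of $p$ (this is the probability that $U$ outputs a string starting with $x$ when fed with uniformly random bits), and let $$\overline{M}_U(x) := \lim_{n\to\infty} \sum_{y \in X^n} M_U(xy).$$ A set $A$ of natural numbers (or of finite objects encoded as such) is $\Sigma^0_2$ if there is a computable relation $S$ with $a \in A \Leftrightarrow \exists k_1 \forall k_2\, S(a,k_1,k_2)$; it is $\Pi^0_2$ if its complement is $\Sigma^0_2$, and $\Delta^0_2$ if it is both.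 **Theorem.** There is a universal monotone machine $U'$ such that the set $$\{(x,q) \in X^* \times \mathbb{Q} \mid \overline{M}_{U'}(x) > q\}$$ is not $\Delta^0_2$ (rational numbers being encoded as fractions $m/(d+1)$ with $m \in \mathbb{Z}$, $d \in \mathbb{N}$). -/

import Mathlib

open Filter Topology
open scoped ENNReal

/-! ### The second level of the arithmetical hierarchy -/

/-- `A` is `Σ⁰₂`: there is a computable relation `S` with `a ∈ A ↔ ∃ k₁, ∀ k₂, S a k₁ k₂`. -/
def IsSigma02 {α : Type*} [Primcodable α] (A : Set α) : Prop :=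
  ∃ S : α → ℕ → ℕ → Prop,
    ComputablePred (fun t : α × ℕ × ℕ => S t.1 t.2.1 t.2.2) ∧
      ∀ a, a ∈ A ↔ ∃ k₁, ∀ k₂, S a k₁ k₂

/-- `A` is `Π⁰₂`: its complement is `Σ⁰₂`. -/
def IsPi02 {α : Type*} [Primcodable α] (A : Set α) : Prop :=
  IsSigma02 Aᶜ

/-- `A` is `Δ⁰₂`: it is both `Σ⁰₂` and `Π⁰₂`. -/
def IsDelta02 {α : Type*} [Primcodable α] (A : Set α) : Prop :=
  IsSigma02 A ∧ IsPi02 A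

/-- The rational number coded by the integer numerator `c.1` and the positive denominator
`c.2 + 1`; every rational number has a code (`ratOfCode_surjective`). -/
def ratOfCode (c : ℤ × ℕ) : ℚ := (c.1 : ℚ) / ((c.2 : ℚ) + 1)

theorem ratOfCode_surjective : Function.Surjective ratOfCode := by
  intro q
  refine ⟨(q.num, q.den - 1), ?_⟩
  have h : ((q.den - 1 : ℕ) : ℚ) + 1 = q.den := by
    have := q.den_pos
    exact_mod_cast (by omega : q.den - 1 + 1 = q.den)
  simp only [ratOfCode, h]
  exact Rat.num_div_den q

/-! ### Strings and monotone machines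

Finite strings over the alphabet `X` are lists, finite or infinite strings are elements of
`Stream'.Seq X`. -/

/-- The finite string `x` is a prefix of the finite or infinite string `s`. -/
def IsInitial {X : Type*} (x : List X) (s : Stream'.Seq X) : Prop :=
  ∀ i < x.length, s.get? i = x[i]?

/-- A monotone machine with binary input and output alphabet `X`: it maps every finite binary
input `p` to the finite or infinite string `out p` that it writes on its one-way output tape when
`p` is on its one-way input tape. More input can only prolong the output, and the finite
prefixes of the output can be effectively enumerated. -/
structure MonotoneMachine (X : Type*) [Primcodable X] where
  /-- The finite or infinite output on a finite input. -/
  out : List Bool → Stream'.Seq X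
  /-- If `p` is a prefix of `q`, then `out p` is a prefix of `out q`. -/
  mono : ∀ p q : List Bool, p <+: q → ∀ i a, (out p).get? i = some a → (out q).get? i = some a
  /-- The relation `x ⊑ out p` is recursively enumerable. -/
  re : REPred fun t : List Bool × List X => IsInitial t.2 (out t.1)

namespace MonotoneMachine

variable {X : Type*} [Primcodable X]

/-- `U` is universal: every monotone machine `T` is simulated by `U` once a suitable finite
binary string `w`, depending only on `T`, is put in front of the input. -/
def IsUniversal (U : MonotoneMachine X) : Prop :=
  ∀ T : MonotoneMachine X, ∃ w : List Bool, ∀ p : List Bool, U.out (w ++ p) = T.out p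

/-- The minimal programs for `x`: the binary strings `p` on which the output of `U` starts with
`x`, while this is the case for no proper prefix of `p`. -/
def minimalPrograms (U : MonotoneMachine X) (x : List X) : Set (List Bool) :=
  {p | IsInitial x (U.out p) ∧ ∀ q, q <+: p → IsInitial x (U.out q) → q = p}

/-- Solomonoff's prior `M_U(x) = ∑ 2^{-|p|}`, the sum over all minimal programs `p` for `x`; it
is the probability that `U` writes a string that starts with `x` when fed with uniformly random
bits (`M_eq_prob`). -/
noncomputable def M (U : MonotoneMachine X) (x : List X) : ℝ≥0∞ :=
  ∑' p : U.minimalPrograms x, (2⁻¹ : ℝ≥0∞) ^ (p : List Bool).length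

/-- The measure mixture `M̄_U(x) = lim_{n → ∞} ∑_{y ∈ Xⁿ} M_U(xy)`. The limit exists and is at
most `1` (`tendsto_MM`, `MM_le_one`). -/
noncomputable def MM [Fintype X] (U : MonotoneMachine X) (x : List X) : ℝ≥0∞ :=
  limUnder atTop fun n : ℕ => ∑ y : Fin n → X, U.M (x ++ List.ofFn y)

/-! ### Existence of the limit -/

open MeasureTheory

/-- The uniform measure on infinite binary sequences. -/
noncomputable def coinMeasure : Measure (ℕ → Bool) :=
  Measure.infinitePi fun _ => (PMF.uniformOfFintype Bool).toMeasure

/-- The infinite binary sequences that start with `p`. -/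
def cyl (p : List Bool) : Set (ℕ → Bool) := {ω | p = List.ofFn fun i : Fin p.length => ω i}

/-- The infinite binary sequences on which the output of `U` starts with `x`. -/
def success (U : MonotoneMachine X) (x : List X) : Set (ℕ → Bool) :=
  {ω | ∃ n : ℕ, IsInitial x (U.out (List.ofFn fun i : Fin n => ω i))}

theorem mem_cyl_ofFn (ω : ℕ → Bool) (n : ℕ) : ω ∈ cyl (List.ofFn fun i : Fin n => ω i) := by
  simp only [cyl, Set.mem_ofPred_eq]
  apply List.ext_getElem <;> simp

theorem prefix_of_cyl {p q : List Bool} {ω : ℕ → Bool} (hp : ω ∈ cyl p) (hq : ω ∈ cyl q)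
    (h : p.length ≤ q.length) : p <+: q := by
  rw [List.prefix_iff_eq_take]
  rw [cyl, Set.mem_ofPred_eq] at hp hq
  apply List.ext_getElem
  · simpa using h
  · intro i h1 h2
    have e1 : p[i] = ω i := by
      have := List.getElem_of_eq hp h1
      simpa using this
    have h3 : i < q.length := by omega
    have e2 : q[i] = ω i := by
      have := List.getElem_of_eq hq h3
      simpa using this
    simp [e1, e2]

instance : IsProbabilityMeasure coinMeasure := by
  unfold coinMeasure; infer_instance

theorem cyl_eq_pi (p : List Bool) :
    cyl p = Set.pi (Finset.range p.length : Finset ℕ) fun i => {p.getD i false} := by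
  ext ω
  simp only [cyl, Set.mem_ofPred_eq, Set.mem_pi, Finset.coe_range, Set.mem_Iio,
    Set.mem_singleton_iff]
  constructor
  · intro h i hi
    have := List.getElem_of_eq h hi
    simp [List.getD, hi, this]
  · intro h
    apply List.ext_getElem
    · simp
    · intro i h1 h2
      have := h i h1
      simp [List.getD, h1] at this
      simp [this]

theorem measurableSet_cyl (p : List Bool) : MeasurableSet (cyl p) := by
  rw [cyl_eq_pi]
  exact MeasurableSet.pi (Finset.countable_toSet _) fun i _ => measurableSet_singleton _

theorem coinMeasure_cyl (p : List Bool) : coinMeasure (cyl p) = (2⁻¹ : ℝ≥0∞) ^ p.length := by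
  rw [cyl_eq_pi, coinMeasure, Measure.infinitePi_pi _ fun i _ => measurableSet_singleton _]
  rw [Finset.prod_congr rfl (g := fun _ => (2⁻¹ : ℝ≥0∞))]
  · simp
  · intro i _
    rw [PMF.toMeasure_apply_singleton _ _ (measurableSet_singleton _)]
    simp

theorem IsInitial_mono (U : MonotoneMachine X) {x : List X} {p q : List Bool} (h : p <+: q)
    (hx : IsInitial x (U.out p)) : IsInitial x (U.out q) := by
  intro i hi
  have h1 := hx i hi
  rw [List.getElem?_eq_getElem hi] at h1 ⊢
  exact U.mono p q h i _ h1

theorem success_eq (U : MonotoneMachine X) (x : List X) :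
    U.success x = ⋃ p : U.minimalPrograms x, cyl (p : List Bool) := by
  classical
  ext ω
  simp only [Set.mem_iUnion, success, Set.mem_ofPred_eq]
  constructor
  · intro h
    refine ⟨⟨List.ofFn fun i : Fin (Nat.find h) => ω i, Nat.find_spec h, ?_⟩, mem_cyl_ofFn _ _⟩
    intro q hq hxq
    by_contra hne
    have hlen : q.length < Nat.find h := by
      have h1 := hq.length_le
      have h2 : q.length ≠ (List.ofFn fun i : Fin (Nat.find h) => ω i).length :=
        fun e => hne (hq.eq_of_length e)
      simp only [List.length_ofFn] at h1 h2
      omega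
    apply Nat.find_min h hlen
    convert hxq using 2
    have h3 : (List.ofFn fun i : Fin q.length => ω i) <+:
        (List.ofFn fun i : Fin (Nat.find h) => ω i) :=
      prefix_of_cyl (mem_cyl_ofFn ω _) (mem_cyl_ofFn ω _) (by simpa using hlen.le)
    exact (List.prefix_of_prefix_length_le h3 hq (by simp)).eq_of_length (by simp)
  · rintro ⟨p, hω⟩
    obtain ⟨hp, -⟩ := p.2
    refine ⟨(p : List Bool).length, ?_⟩
    have h : (p : List Bool) = List.ofFn fun i : Fin (p : List Bool).length => ω i := hω
    rwa [← h]

theorem measurableSet_success (U : MonotoneMachine X) (x : List X) :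
    MeasurableSet (U.success x) := by
  rw [success_eq]
  exact MeasurableSet.iUnion fun p => measurableSet_cyl _

theorem M_eq_prob (U : MonotoneMachine X) (x : List X) :
    U.M x = coinMeasure (U.success x) := by
  rw [success_eq, measure_iUnion _ fun p => measurableSet_cyl _]
  · simp only [coinMeasure_cyl, M]
  · intro p q hpq
    rw [Function.onFun, Set.disjoint_left]
    intro ω hp hq
    apply hpq
    apply Subtype.ext
    rcases le_total (p : List Bool).length (q : List Bool).length with h | h
    · exact q.2.2 _ (prefix_of_cyl hp hq h) p.2.1
    · exact (p.2.2 _ (prefix_of_cyl hq hp h) q.2.1).symm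

theorem sum_M_eq [Fintype X] (U : MonotoneMachine X) (x : List X) (n : ℕ) :
    ∑ y : Fin n → X, U.M (x ++ List.ofFn y) =
      coinMeasure (⋃ y : Fin n → X, U.success (x ++ List.ofFn y)) := by
  rw [measure_iUnion _ fun y => measurableSet_success _ _, tsum_fintype]
  · simp only [M_eq_prob]
  · intro y z hyz
    rw [Function.onFun, Set.disjoint_left]
    rintro ω ⟨m, hm⟩ ⟨k, hk⟩
    apply hyz
    have hm' := U.IsInitial_mono (prefix_of_cyl (mem_cyl_ofFn ω m) (mem_cyl_ofFn ω (max m k))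
      (by simp)) hm
    have hk' := U.IsInitial_mono (prefix_of_cyl (mem_cyl_ofFn ω k) (mem_cyl_ofFn ω (max m k))
      (by simp)) hk
    funext i
    have h1 := hm' (x.length + i) (by simp)
    have h2 := hk' (x.length + i) (by simp)
    rw [h1] at h2
    simpa using h2

theorem antitone_sum_M [Fintype X] (U : MonotoneMachine X) (x : List X) :
    Antitone fun n : ℕ => ∑ y : Fin n → X, U.M (x ++ List.ofFn y) := by
  apply antitone_nat_of_succ_le
  intro n
  rw [sum_M_eq, sum_M_eq]
  apply measure_mono
  intro ω hω
  simp only [Set.mem_iUnion] at hω ⊢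
  obtain ⟨y, m, hm⟩ := hω
  refine ⟨fun i => y i.castSucc, m, fun i hi => ?_⟩
  have hi' : i < (x ++ List.ofFn y).length := by
    simp only [List.length_append, List.length_ofFn] at hi ⊢
    omega
  rw [hm i hi', List.getElem?_eq_getElem hi, List.getElem?_eq_getElem hi', List.getElem_append,
    List.getElem_append]
  split_ifs
  · rfl
  · rw [List.getElem_ofFn, List.getElem_ofFn]
    rfl

theorem tendsto_MM [Fintype X] (U : MonotoneMachine X) (x : List X) :
    Tendsto (fun n : ℕ => ∑ y : Fin n → X, U.M (x ++ List.ofFn y)) atTop (𝓝 (U.MM x)) :=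
  tendsto_nhds_limUnder ⟨_, tendsto_atTop_iInf (U.antitone_sum_M x)⟩

theorem MM_le_one [Fintype X] (U : MonotoneMachine X) (x : List X) : U.MM x ≤ 1 :=
  le_of_tendsto' (U.tendsto_MM x) fun n => by
    rw [sum_M_eq]
    exact prob_le_one

end MonotoneMachine

/-!
The theorem follows from a comparison of two universal machines. Let `U` be any universal machine
(`isUniversal_universal`) and `T` any machine, and let the machine `branch T U` run `T` or `U` on
the remaining input when the first input bit is `0` or `1`. It is universal too, and
`M̄_{branch T U} = (M̄_T + M̄_U) / 2` (`MM_branch`). So `M̄_T(x) > 0` holds if and only if there is a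
rational number `q` with `M̄_{branch T U}(x) > q` and not `M̄_U(x) > 2q`
(`exists_ratOfCode_between`). If the sets `{(x, q) | M̄(x) > q}` of both machines were `Δ⁰₂`, then
`{x | M̄_T(x) > 0}` would be `Σ⁰₂`.

The machine `T` is chosen so that this fails. The set `diagTotal` of all `n` such that the `n`-th
partial recursive function is defined at all pairs `(n, k)` is not `Σ⁰₂`, by diagonalization
(`not_isSigma02_diagTotal`). On inputs that start with `1ⁿ0`, the machine `diag a b` writes `aⁿb`
and one more `a` for each `k` in turn at which the computation at `(n, k)` halts. The output is
infinite if `n ∈ diagTotal`, and otherwise no output extends `aⁿb` by more than a fixed number of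
symbols; hence `M̄_T(aⁿb) > 0` if and only if `n ∈ diagTotal` (`MM_diag_pos_iff`). Therefore `U` or
`branch T U` proves the theorem.

Machines are obtained from recursively enumerable sets of instructions "on input `p` write at least
`y`" in which comparable inputs come with comparable outputs (`ofRel`). For the universal machine,
all recursively enumerable sets of pairs are run in parallel, and an enumerated pair is accepted
only if it is compatible with all pairs enumerated earlier: this always gives consistent
instructions, and nothing is lost when the enumerated set comes from a machine.
-/

open Nat.Partrec (Code)
open Nat.Partrec.Code (eval evaln evaln_complete primrec_evaln)

/-! ### Recursively enumerable predicates -/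

section REPred

variable {α β : Type*} [Primcodable α] [Primcodable β]

/-- The steps `k` bound the computation, so that the relation under the quantifier is decidable. -/
theorem REPred.exists_code {p : α → Prop} (hp : REPred p) :
    ∃ c : Code, ∀ a, p a ↔ ∃ k, (evaln k c (Encodable.encode a)).isSome := by
  obtain ⟨c, hc⟩ := Nat.Partrec.Code.exists_code.1 hp
  refine ⟨c, fun a => ?_⟩
  have h : (eval c (Encodable.encode a)).Dom ↔ p a := by
    rw [hc]; simp [Part.assert]
  rw [← h, Part.dom_iff_mem]
  simp only [evaln_complete, Option.isSome_iff_exists, Option.mem_def]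
  exact exists_comm

theorem REPred.comp {p : β → Prop} (hp : REPred p) {f : α → β} (hf : Computable f) :
    REPred fun a => p (f a) :=
  Partrec.comp hp hf

theorem ComputablePred.exists_nat_re {R : α → ℕ → Prop}
    (hR : ComputablePred fun t : α × ℕ => R t.1 t.2) : REPred fun a => ∃ k, R a k := by
  classical
  have h1 : Computable₂ fun (a : α) (k : ℕ) => decide (R a k) := hR.decide
  refine (Partrec.rfind h1.partrec₂).dom_re.of_eq fun a => ?_
  rw [Nat.rfind_dom]
  simp

theorem REPred.exists_primrecRel {p : α → Prop} (hp : REPred p) :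
    ∃ R : α → ℕ → Prop, PrimrecRel R ∧ ∀ a, p a ↔ ∃ k, R a k := by
  obtain ⟨c, hc⟩ := hp.exists_code
  refine ⟨fun a k => (evaln k c (Encodable.encode a)).isSome, ?_, hc⟩
  refine Primrec.primrecPred ((Primrec.option_isSome.comp (primrec_evaln.comp
    ((Primrec.snd.pair (Primrec.const c)).pair (Primrec.encode.comp Primrec.fst)))).of_eq ?_)
  simp

theorem PrimrecPred.exists_re {R : α → β → Prop}
    (hR : PrimrecPred fun t : α × β => R t.1 t.2) : REPred fun a => ∃ b, R a b := by
  have h : PrimrecPred fun t : α × ℕ => ∃ b ∈ (Encodable.decode (α := β) t.2).toList, R t.1 b :=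
    PrimrecRel.comp (R := fun (L : List β) (a : α) => ∃ b ∈ L, R a b)
      (PrimrecRel.exists_mem_list (R := fun b a => R a b)
        (PrimrecPred.comp hR (Primrec.snd.pair Primrec.fst)))
      (Primrec.optionToList.comp (Primrec.decode.comp Primrec.snd)) Primrec.fst
  refine (ComputablePred.exists_nat_re (R := fun a k =>
    ∃ b ∈ (Encodable.decode (α := β) k).toList, R a b) h.computablePred).of_eq fun a => ?_
  constructor
  · rintro ⟨k, b, -, hb⟩
    exact ⟨b, hb⟩
  · rintro ⟨b, hb⟩
    exact ⟨Encodable.encode b, b, by simp, hb⟩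

theorem REPred.exists {p : α → β → Prop} (hp : REPred fun t : α × β => p t.1 t.2) :
    REPred fun a => ∃ b, p a b := by
  obtain ⟨R, hR, h⟩ := hp.exists_primrecRel
  refine (PrimrecPred.exists_re (R := fun (a : α) (u : β × ℕ) => R (a, u.1) u.2)
    (hR.comp (Primrec.fst.pair (Primrec.fst.comp Primrec.snd))
      (Primrec.snd.comp Primrec.snd))).of_eq fun a => ?_
  simp only [Prod.exists]
  exact exists_congr fun b => (h (a, b)).symm

theorem REPred.and {p q : α → Prop} (hp : REPred p) (hq : REPred q) :
    REPred fun a => p a ∧ q a := by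
  obtain ⟨R, hR, h⟩ := hp.exists_primrecRel
  obtain ⟨S, hS, h'⟩ := hq.exists_primrecRel
  refine (PrimrecPred.exists_re (R := fun (a : α) (u : ℕ × ℕ) => R a u.1 ∧ S a u.2)
    ((hR.comp Primrec.fst (Primrec.fst.comp Primrec.snd)).and
      (hS.comp Primrec.fst (Primrec.snd.comp Primrec.snd)))).of_eq fun a => ?_
  simp [h, h']

theorem REPred.or {p q : α → Prop} (hp : REPred p) (hq : REPred q) :
    REPred fun a => p a ∨ q a := by
  obtain ⟨k, hk, h⟩ := Partrec.merge' hp hq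
  refine hk.dom_re.of_eq fun a => (h a).2.trans ?_
  simp [Part.assert]

theorem primrecRel_prefix : PrimrecRel fun x y : List α => x <+: y := by
  classical
  refine PrimrecPred.of_eq (PrimrecRel.comp Primrec.eq Primrec.fst
    (Primrec.list_take.comp (Primrec.list_length.comp Primrec.fst) Primrec.snd)) fun t => ?_
  exact List.prefix_iff_eq_take.symm

theorem primrec_replicate (a : α) : Primrec fun n : ℕ => List.replicate n a :=
  (Primrec.list_map Primrec.list_range (Primrec.const a).to₂).of_eq fun n => by
    simp

end REPred

/-! ### The second level of the arithmetical hierarchy -/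

section Sigma02

variable {α β : Type*} [Primcodable α] [Primcodable β]

theorem ComputablePred.comp {p : β → Prop} (hp : ComputablePred p) {f : α → β}
    (hf : Computable f) : ComputablePred fun a => p (f a) :=
  computable_of_manyOneReducible ⟨f, hf, fun _ => Iff.rfl⟩ hp

theorem ComputablePred.and {p q : α → Prop} (hp : ComputablePred p) (hq : ComputablePred q) :
    ComputablePred fun a => p a ∧ q a := by
  classical
  exact ((Primrec.and.to_comp.comp hp.decide hq.decide).of_eq fun a => by simp).computablePred

theorem IsSigma02.preimage {A : Set β} (hA : IsSigma02 A) {f : α → β} (hf : Computable f) :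
    IsSigma02 (f ⁻¹' A) := by
  obtain ⟨S, hS, h⟩ := hA
  exact ⟨fun a => S (f a), hS.comp ((hf.comp Computable.fst).pair Computable.snd),
    fun a => h (f a)⟩

theorem IsSigma02.inter {A B : Set α} (hA : IsSigma02 A) (hB : IsSigma02 B) :
    IsSigma02 (A ∩ B) := by
  obtain ⟨S, hS, h⟩ := hA
  obtain ⟨S', hS', h'⟩ := hB
  refine ⟨fun a k l => S a k.unpair.1 l ∧ S' a k.unpair.2 l, ?_, fun a => ?_⟩
  · have hk : Computable fun t : α × ℕ × ℕ => t.2.1.unpair :=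
      Computable.unpair.comp (Computable.fst.comp Computable.snd)
    have hl : Computable fun t : α × ℕ × ℕ => t.2.2 := Computable.snd.comp Computable.snd
    exact (hS.comp (Computable.fst.pair ((Computable.fst.comp hk).pair hl))).and
      (hS'.comp (Computable.fst.pair ((Computable.snd.comp hk).pair hl)))
  · rw [Set.mem_inter_iff, h, h']
    constructor
    · rintro ⟨⟨k, hk⟩, k', hk'⟩
      exact ⟨Nat.pair k k', fun l => by simpa using ⟨hk l, hk' l⟩⟩
    · rintro ⟨k, hk⟩
      exact ⟨⟨_, fun l => (hk l).1⟩, _, fun l => (hk l).2⟩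

theorem IsSigma02.exists_nat {P : α → ℕ → Prop} (hP : IsSigma02 {t : α × ℕ | P t.1 t.2}) :
    IsSigma02 {a | ∃ n, P a n} := by
  obtain ⟨S, hS, h⟩ := hP
  refine ⟨fun a k l => S (a, k.unpair.1) k.unpair.2 l, ?_, fun a => ?_⟩
  · have hk : Computable fun t : α × ℕ × ℕ => t.2.1.unpair :=
      Computable.unpair.comp (Computable.fst.comp Computable.snd)
    have hl : Computable fun t : α × ℕ × ℕ => t.2.2 := Computable.snd.comp Computable.snd
    exact hS.comp ((Computable.fst.pair (Computable.fst.comp hk)).pair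
      ((Computable.snd.comp hk).pair hl))
  · have h' : ∀ n, P a n ↔ ∃ k, ∀ l, S (a, n) k l := fun n => h (a, n)
    simp only [Set.mem_ofPred_eq, h']
    constructor
    · rintro ⟨n, k, hk⟩
      exact ⟨Nat.pair n k, fun l => by simpa using hk l⟩
    · rintro ⟨k, hk⟩
      exact ⟨_, _, hk⟩

/-- The numbers `n` such that the `n`-th partial recursive function is defined at all pairs
`(n, k)`: the diagonal of a universal `Π⁰₂` set. -/
def diagTotal : Set ℕ := {n | ∀ k, (eval (Denumerable.ofNat Code n) (Nat.pair n k)).Dom}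

theorem not_isSigma02_diagTotal : ¬ IsSigma02 diagTotal := by
  rintro ⟨S, hS, h⟩
  have hre : REPred fun m : ℕ => ∃ l, ¬ S m.unpair.1 m.unpair.2 l :=
    ComputablePred.exists_nat_re (R := fun (m l : ℕ) => ¬ S m.unpair.1 m.unpair.2 l)
      (hS.not.comp (f := fun t : ℕ × ℕ => (t.1.unpair.1, t.1.unpair.2, t.2))
        ((Computable.fst.comp (Computable.unpair.comp Computable.fst)).pair
          ((Computable.snd.comp (Computable.unpair.comp Computable.fst)).pair Computable.snd)))
  obtain ⟨c, hc⟩ := hre.exists_code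
  have hdom : ∀ m, (eval c m).Dom ↔ ∃ l, ¬ S (Nat.unpair m).1 (Nat.unpair m).2 l := fun m => by
    rw [hc, Part.dom_iff_mem]
    simp only [evaln_complete, Option.isSome_iff_exists, Option.mem_def, Encodable.encode_nat]
    exact exists_comm
  -- at the index of a code for the complement, membership contradicts itself
  have key := h (Encodable.encode c)
  simp only [diagTotal, Set.mem_ofPred_eq, Denumerable.ofNat_encode, hdom, Nat.unpair_pair] at key
  have key' : (∀ k, ∃ l, ¬ S (Encodable.encode c) k l) ↔
      ¬ ∀ k, ∃ l, ¬ S (Encodable.encode c) k l := key.trans (by push Not; rfl)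
  tauto

end Sigma02

/-! ### Finite prefixes of finite or infinite strings -/

section IsInitial

variable {X : Type*}

theorem isInitial_iff {x : List X} {s : Stream'.Seq X} :
    IsInitial x s ↔ ∀ i a, x[i]? = some a → s.get? i = some a := by
  constructor
  · intro h i a hx
    rw [h i (List.getElem?_eq_some_iff.1 hx).1, hx]
  · intro h i hi
    rw [List.getElem?_eq_getElem hi, h i x[i] (List.getElem?_eq_getElem hi)]

theorem isInitial_nil (s : Stream'.Seq X) : IsInitial [] s := fun i hi => by simp at hi

theorem IsInitial.prefix_or_prefix {x y : List X} {s : Stream'.Seq X} (hx : IsInitial x s)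
    (hy : IsInitial y s) : x <+: y ∨ y <+: x := by
  have key : ∀ {x y : List X}, IsInitial x s → IsInitial y s → x.length ≤ y.length → x <+: y := by
    intro x y hx hy h
    rw [List.prefix_iff_getElem?]
    intro i hi
    rw [← hy i (hi.trans_le h), hx i hi, List.getElem?_eq_getElem hi]
  exact (le_total x.length y.length).imp (key hx hy) (key hy hx)

theorem IsInitial.of_prefix {x y : List X} {s : Stream'.Seq X} (hy : IsInitial y s)
    (h : x <+: y) : IsInitial x s := by
  rw [isInitial_iff] at hy ⊢
  intro i a hx
  obtain ⟨hi, rfl⟩ := List.getElem?_eq_some_iff.1 hx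
  exact hy i _ (List.prefix_iff_getElem?.1 h i hi)

theorem exists_isInitial_of_get? {s : Stream'.Seq X} {n : ℕ} {a : X} (h : s.get? n = some a) :
    ∃ x : List X, x[n]? = some a ∧ IsInitial x s := by
  have key : ∀ n, (s.get? n).isSome → ∃ x : List X, x.length = n + 1 ∧ IsInitial x s := by
    intro n hn
    refine ⟨List.ofFn fun i : Fin (n + 1) => (s.get? i).get ?_, by simp, ?_⟩
    · by_contra hi
      rw [Bool.not_eq_true, Option.isSome_eq_false_iff, Option.isNone_iff_eq_none] at hi
      rw [s.le_stable (Nat.lt_succ_iff.1 i.2) hi] at hn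
      simp at hn
    · intro i hi
      rw [List.getElem?_eq_getElem hi, List.getElem_ofFn, Option.some_get]
  obtain ⟨x, hlen, hx⟩ := key n (by simp [h])
  exact ⟨x, by rw [← hx n (by omega), h], hx⟩

theorem seq_ext_of_isInitial {s t : Stream'.Seq X} (h : ∀ x, IsInitial x s ↔ IsInitial x t) :
    s = t := by
  have key : ∀ {s t : Stream'.Seq X}, (∀ x, IsInitial x s → IsInitial x t) →
      ∀ n a, s.get? n = some a → t.get? n = some a := by
    intro s t h n a hn
    obtain ⟨x, hxn, hx⟩ := exists_isInitial_of_get? hn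
    exact isInitial_iff.1 (h x hx) n a hxn
  exact Stream'.Seq.ext fun n => Option.ext fun a =>
    ⟨key (fun x => (h x).1) n a, key (fun x => (h x).2) n a⟩

end IsInitial

/-! ### Machines from consistent enumerable relations -/

namespace MonotoneMachine

variable {X : Type*}

/-- `R p y`, read as the instruction to write at least `y` on input `p`, is consistent if
instructions for comparable inputs ask for comparable outputs. -/
def Consistent (R : List Bool → List X → Prop) : Prop :=
  ∀ p q x y, p <+: q → R p x → R q y → x <+: y ∨ y <+: x

/-- The symbol at position `i` that the instructions `R` ask for on input `p`. -/
def Requests (R : List Bool → List X → Prop) (p : List Bool) (i : ℕ) (a : X) : Prop :=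
  ∃ q, q <+: p ∧ ∃ y, R q y ∧ y[i]? = some a

theorem Consistent.prefix_or_prefix {R : List Bool → List X → Prop} (hR : Consistent R)
    {p q q' : List Bool} {x y : List X} (hq : q <+: p) (hq' : q' <+: p) (hx : R q x)
    (hy : R q' y) : x <+: y ∨ y <+: x := by
  rcases List.prefix_or_prefix_of_prefix hq hq' with h | h
  · exact hR _ _ _ _ h hx hy
  · exact (hR _ _ _ _ h hy hx).symm

theorem getElem?_eq_of_prefix_or_prefix {x y : List X} (h : x <+: y ∨ y <+: x) {i : ℕ} {a b : X}
    (ha : x[i]? = some a) (hb : y[i]? = some b) : a = b := by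
  obtain ⟨hi, rfl⟩ := List.getElem?_eq_some_iff.1 ha
  obtain ⟨hi', rfl⟩ := List.getElem?_eq_some_iff.1 hb
  rcases h with h | h
  · exact h.getElem hi
  · exact (h.getElem hi').symm

theorem Consistent.requests_unique {R : List Bool → List X → Prop} (hR : Consistent R)
    {p : List Bool} {i : ℕ} {a b : X} (ha : Requests R p i a) (hb : Requests R p i b) :
    a = b := by
  obtain ⟨q, hq, x, hx, ha⟩ := ha
  obtain ⟨q', hq', y, hy, hb⟩ := hb
  exact getElem?_eq_of_prefix_or_prefix (hR.prefix_or_prefix hq hq' hx hy) ha hb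

open Classical in
/-- The output on input `p` that the instructions `R` ask for. -/
noncomputable def seqOfRel (R : List Bool → List X → Prop) (p : List Bool) : Stream'.Seq X where
  val i := if h : ∃ a, Requests R p i a then some h.choose else none
  property := by
    intro i hi
    rw [dite_eq_right_iff] at hi ⊢
    rintro ⟨a, q, hq, y, hy, ha⟩
    have hlen : i < y.length := by
      have := (List.getElem?_eq_some_iff.1 ha).1
      omega
    exact absurd (hi ⟨y[i], q, hq, y, hy, List.getElem?_eq_getElem hlen⟩) (by simp)

theorem Consistent.get?_seqOfRel {R : List Bool → List X → Prop} (hR : Consistent R)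
    {p : List Bool} {i : ℕ} {a : X} :
    (seqOfRel R p).get? i = some a ↔ Requests R p i a := by
  classical
  change (if h : ∃ a, Requests R p i a then some h.choose else none) = some a ↔ _
  split_ifs with h
  · rw [Option.some_inj]
    exact ⟨fun e => e ▸ h.choose_spec, fun ha => hR.requests_unique h.choose_spec ha⟩
  · simp only [false_iff]
    exact fun ha => h ⟨a, ha⟩

/-- A finite prefix of the output is already asked for by a single instruction. -/
theorem Consistent.isInitial_seqOfRel {R : List Bool → List X → Prop} (hR : Consistent R)
    {p : List Bool} {x : List X} :
    IsInitial x (seqOfRel R p) ↔ x = [] ∨ ∃ q, q <+: p ∧ ∃ y, R q y ∧ x <+: y := by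
  rw [isInitial_iff]
  simp only [hR.get?_seqOfRel]
  constructor
  · intro h
    rcases List.eq_nil_or_concat x with rfl | ⟨z, a, rfl⟩
    · exact Or.inl rfl
    right
    -- the instruction that asks for the last symbol asks for all earlier ones as well
    obtain ⟨q, hq, y, hy, hya⟩ := h z.length a (by simp)
    refine ⟨q, hq, y, hy, List.prefix_iff_getElem?.2 fun i hi => ?_⟩
    have hlen := (List.getElem?_eq_some_iff.1 hya).1
    have hi' : i < y.length := by simp at hi; omega
    rw [List.getElem?_eq_getElem hi', hR.requests_unique (h i _ (List.getElem?_eq_getElem hi))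
      ⟨q, hq, y, hy, List.getElem?_eq_getElem hi'⟩]
  · rintro (rfl | ⟨q, hq, y, hy, hxy⟩) i a hx
    · simp at hx
    · obtain ⟨hi, rfl⟩ := List.getElem?_eq_some_iff.1 hx
      exact ⟨q, hq, y, hy, List.prefix_iff_getElem?.1 hxy i hi⟩

/-- Comparable inputs come with comparable outputs. -/
def Compat (t u : List Bool × List X) : Prop :=
  (t.1 <+: u.1 ∨ u.1 <+: t.1) → (t.2 <+: u.2 ∨ u.2 <+: t.2)

theorem Compat.symm {t u : List Bool × List X} (h : Compat t u) : Compat u t :=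
  fun h' => (h h'.symm).symm

variable [Primcodable X]

/-- The machine that carries out a consistent, recursively enumerable set of instructions. -/
noncomputable def ofRel (R : List Bool → List X → Prop) (hR : Consistent R)
    (hre : REPred fun t : List Bool × List X => R t.1 t.2) : MonotoneMachine X where
  out := seqOfRel R
  mono p q hpq i a h := by
    rw [hR.get?_seqOfRel] at h ⊢
    obtain ⟨q', hq', h⟩ := h
    exact ⟨q', hq'.trans hpq, h⟩
  re := by
    classical
    have h1 : REPred fun t : (List Bool × List X) × (List Bool × List X) =>
        (t.2.1 <+: t.1.1 ∧ t.1.2 <+: t.2.2) ∧ R t.2.1 t.2.2 :=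
      ((primrecRel_prefix.comp (Primrec.fst.comp Primrec.snd)
        (Primrec.fst.comp Primrec.fst)).and (primrecRel_prefix.comp
          (Primrec.snd.comp Primrec.fst)
            (Primrec.snd.comp Primrec.snd))).computablePred.to_re.and (hre.comp Computable.snd)
    have h2 : REPred fun t : List Bool × List X => t.2 = [] :=
      (Primrec.eq.comp Primrec.snd (Primrec.const [])).computablePred.to_re
    refine (h2.or (REPred.exists (p := fun (t u : List Bool × List X) =>
      (u.1 <+: t.1 ∧ t.2 <+: u.2) ∧ R u.1 u.2) h1)).of_eq fun t => ?_
    rw [hR.isInitial_seqOfRel]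
    simp only [Prod.exists]
    refine or_congr_right (exists_congr fun q => ?_)
    constructor
    · rintro ⟨y, ⟨h, h'⟩, h''⟩
      exact ⟨h, y, h'', h'⟩
    · rintro ⟨h, y, h'', h'⟩
      exact ⟨y, ⟨h, h'⟩, h''⟩

theorem isInitial_ofRel {R : List Bool → List X → Prop} {hR : Consistent R}
    {hre : REPred fun t : List Bool × List X => R t.1 t.2} {p : List Bool} {x : List X} :
    IsInitial x ((ofRel R hR hre).out p) ↔ x = [] ∨ ∃ q, q <+: p ∧ ∃ y, R q y ∧ x <+: y :=
  hR.isInitial_seqOfRel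

/-! ### A universal machine -/

/-- The unary self-delimiting code `1ⁿ0` of `n`. -/
def unary (n : ℕ) : List Bool := List.replicate n true ++ [false]

theorem unary_append_prefix {m n : ℕ} {p q : List Bool} :
    unary m ++ p <+: unary n ++ q ↔ m = n ∧ p <+: q := by
  induction m generalizing n with
  | zero => cases n <;> simp [unary, List.replicate_succ]
  | succ m ih =>
    cases n with
    | zero => simp [unary, List.replicate_succ]
    | succ n => simpa [unary, List.replicate_succ] using @ih n

theorem primrec_unary : Primrec unary :=
  Primrec.list_append.comp (primrec_replicate true) (Primrec.const [false])

variable (X) in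
/-- The `s`-th pair in an enumeration of the pairs accepted by the `i`-th partial recursive
function. The pair `([], [])`, which asks for nothing, stands for `no new pair`. -/
def item (i s : ℕ) : List Bool × List X :=
  ((Encodable.decode (α := List Bool × List X) s.unpair.2).bind fun t =>
    (evaln s.unpair.1 (Denumerable.ofNat Code i) (Encodable.encode t)).map fun _ => t).getD ([], [])

theorem primrec₂_item : Primrec₂ (item X) := by
  have hs : Primrec fun t : ℕ × ℕ => t.2.unpair := Primrec.unpair.comp Primrec.snd
  refine Primrec.option_getD.comp (Primrec.option_bind
    (Primrec.decode.comp (Primrec.snd.comp hs)) ?_) (Primrec.const ([], []))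
  refine Primrec.option_map (primrec_evaln.comp
    (((Primrec.fst.comp (hs.comp Primrec.fst)).pair ((Primrec.ofNat Code).comp
      (Primrec.fst.comp Primrec.fst))).pair (Primrec.encode.comp Primrec.snd))) ?_
  exact (Primrec.snd.comp Primrec.fst).to₂

theorem primrecRel_prefix_or_prefix {α : Type*} [Primcodable α] :
    PrimrecRel fun x y : List α => x <+: y ∨ y <+: x :=
  PrimrecPred.or (p := fun t : List α × List α => t.1 <+: t.2) (q := fun t => t.2 <+: t.1)
    primrecRel_prefix (primrecRel_prefix.comp Primrec.snd Primrec.fst)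

theorem primrecRel_compat : PrimrecRel (Compat (X := X)) := by
  refine PrimrecPred.of_eq ((primrecRel_prefix_or_prefix.comp (Primrec.fst.comp Primrec.fst)
    (Primrec.fst.comp Primrec.snd)).not.or (primrecRel_prefix_or_prefix.comp
      (Primrec.snd.comp Primrec.fst) (Primrec.snd.comp Primrec.snd))) fun t => ?_
  exact imp_iff_not_or.symm

/-- The instructions of the universal machine: carry out on input `1ⁱ0p` those instructions of the
`i`-th enumeration for `p` that are compatible with all earlier ones. -/
def UniversalRel (w : List Bool) (y : List X) : Prop :=
  ∃ u : ℕ × ℕ × List Bool, w = unary u.1 ++ u.2.2 ∧ item X u.1 u.2.1 = (u.2.2, y) ∧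
    ∀ r < u.2.1, Compat (item X u.1 r) (item X u.1 u.2.1)

theorem consistent_universalRel : Consistent (UniversalRel (X := X)) := by
  rintro _ _ x y hpq ⟨⟨i, s, p⟩, rfl, hs, hs'⟩ ⟨⟨j, t, q⟩, rfl, ht, ht'⟩
  obtain ⟨rfl, hpq⟩ := unary_append_prefix.1 hpq
  dsimp only at *
  have h : Compat (item X i s) (item X i t) := by
    rcases lt_trichotomy s t with h | rfl | h
    · exact ht' s h
    · exact fun _ => Or.inl (List.prefix_refl _)
    · exact (hs' t h).symm
  rw [hs, ht] at h
  exact h (Or.inl hpq)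

theorem re_universalRel : REPred fun t : List Bool × List X => UniversalRel t.1 t.2 := by
  classical
  refine PrimrecPred.exists_re (R := fun (t : List Bool × List X) (u : ℕ × ℕ × List Bool) =>
    t.1 = unary u.1 ++ u.2.2 ∧ item X u.1 u.2.1 = (u.2.2, t.2) ∧
    ∀ r < u.2.1, Compat (item X u.1 r) (item X u.1 u.2.1)) ?_
  let τ := (List Bool × List X) × (ℕ × ℕ × List Bool)
  have hi : Primrec fun t : τ => t.2.1 := Primrec.fst.comp Primrec.snd
  have hs : Primrec fun t : τ => t.2.2.1 := Primrec.fst.comp (Primrec.snd.comp Primrec.snd)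
  have hp : Primrec fun t : τ => t.2.2.2 := Primrec.snd.comp (Primrec.snd.comp Primrec.snd)
  have h3 : PrimrecRel fun (n : ℕ) (v : ℕ × ℕ) =>
      ∀ r < n, Compat (item X v.1 r) (item X v.1 v.2) := by
    have h := PrimrecRel.forall_mem_list
      (R := fun (r : ℕ) (v : ℕ × ℕ) => Compat (item X v.1 r) (item X v.1 v.2))
      (primrecRel_compat.comp
        (primrec₂_item.comp (Primrec.fst.comp Primrec.snd) Primrec.fst)
        (primrec₂_item.comp (Primrec.fst.comp Primrec.snd) (Primrec.snd.comp Primrec.snd)))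
    exact PrimrecPred.of_eq (h.comp (Primrec.list_range.comp Primrec.fst) Primrec.snd)
      fun t => by simp
  exact (Primrec.eq.comp (Primrec.fst.comp Primrec.fst)
    (Primrec.list_append.comp (primrec_unary.comp hi) hp)).and
    ((Primrec.eq.comp (primrec₂_item.comp hi hs)
      (hp.pair (Primrec.snd.comp Primrec.fst))).and (h3.comp hs (hi.pair hs)))

variable (X) in
/-- A universal monotone machine. -/
noncomputable def universal : MonotoneMachine X :=
  ofRel UniversalRel consistent_universalRel re_universalRel

theorem isUniversal_universal : (universal X).IsUniversal := by
  intro T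
  obtain ⟨c, hc⟩ := T.re.exists_code
  have hitem : ∀ s, IsInitial (item X (Encodable.encode c) s).2
      (T.out (item X (Encodable.encode c) s).1) := by
    intro s
    simp only [item, Denumerable.ofNat_encode]
    rcases Encodable.decode (α := List Bool × List X) s.unpair.2 with - | t
    · exact isInitial_nil _
    rcases hd : evaln s.unpair.1 c (Encodable.encode t) with - | v
    · simpa [hd] using isInitial_nil _
    · simpa [hd] using (hc t).2 ⟨s.unpair.1, by simp [hd]⟩
  have hcompat : ∀ r s, Compat (item X (Encodable.encode c) r) (item X (Encodable.encode c) s) := by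
    rintro r s (h | h)
    · exact (T.IsInitial_mono h (hitem r)).prefix_or_prefix (hitem s)
    · exact (hitem r).prefix_or_prefix (T.IsInitial_mono h (hitem s))
  refine ⟨unary (Encodable.encode c), fun p => seq_ext_of_isInitial fun x => ?_⟩
  rw [universal, isInitial_ofRel]
  constructor
  · rintro (rfl | ⟨-, hq, y, ⟨⟨i, s, q⟩, rfl, hs, -⟩, hxy⟩)
    · exact isInitial_nil _
    · obtain ⟨rfl, hq⟩ := unary_append_prefix.1 hq
      have h := hitem s
      dsimp only at hs
      rw [hs] at h
      exact (T.IsInitial_mono hq h).of_prefix hxy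
  · intro hx
    obtain ⟨k, hk⟩ := (hc (p, x)).1 hx
    obtain ⟨v, hv⟩ := Option.isSome_iff_exists.1 hk
    refine Or.inr ⟨_, List.prefix_refl _, x, ⟨(Encodable.encode c,
      Nat.pair k (Encodable.encode (p, x)), p), rfl, ?_, fun r _ => hcompat _ _⟩,
      List.prefix_refl _⟩
    simp only [item, Nat.unpair_pair, Encodable.encodek, Denumerable.ofNat_encode,
      Option.bind_some, hv, Option.map_some, Option.getD_some]

end MonotoneMachine

/-! ### A machine that encodes a `Π⁰₂` set -/

namespace MonotoneMachine

variable {X : Type*}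

/-- The string `aⁿb`. -/
def marker (a b : X) (n : ℕ) : List X := List.replicate n a ++ [b]

theorem marker_append_prefix {a b : X} (hab : a ≠ b) {m n : ℕ} {x y : List X} :
    marker a b m ++ x <+: marker a b n ++ y ↔ m = n ∧ x <+: y := by
  induction m generalizing n with
  | zero => cases n <;> simp [marker, List.replicate_succ, hab.symm]
  | succ m ih =>
    cases n with
    | zero => simp [marker, List.replicate_succ, hab]
    | succ n => simpa [marker, List.replicate_succ] using @ih n

theorem replicate_prefix_replicate (a : X) {k l : ℕ} (h : k ≤ l) :
    List.replicate k a <+: List.replicate l a :=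
  ⟨List.replicate (l - k) a, by rw [List.replicate_append_replicate, Nat.add_sub_cancel' h]⟩

/-- The instructions of the machine that writes, on every input that starts with `1ⁿ0`, the string
`aⁿb` followed by `aᵏ` for every `k` such that the `n`-th partial recursive function is defined at
`(n, 0), …, (n, k - 1)`. -/
def DiagRel (a b : X) (w : List Bool) (y : List X) : Prop :=
  ∃ u : ℕ × ℕ × ℕ, w = unary u.1 ∧ y = marker a b u.1 ++ List.replicate u.2.1 a ∧
    ∀ j < u.2.1, (evaln u.2.2 (Denumerable.ofNat Code u.1) (Nat.pair u.1 j)).isSome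

theorem consistent_diagRel (a b : X) : Consistent (DiagRel a b) := by
  rintro _ _ _ _ hpq ⟨⟨i, k, m⟩, rfl, rfl, -⟩ ⟨⟨j, l, m'⟩, rfl, rfl, -⟩
  dsimp only at *
  have h := unary_append_prefix (m := i) (n := j) (p := []) (q := [])
  simp only [List.append_nil, List.prefix_refl, and_true] at h
  obtain rfl := h.1 hpq
  simp only [List.prefix_append_right_inj]
  exact (le_total k l).imp (replicate_prefix_replicate a) (replicate_prefix_replicate a)

variable [Primcodable X]

theorem primrec_marker (a b : X) : Primrec (marker a b) :=
  Primrec.list_append.comp (primrec_replicate a) (Primrec.const [b])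

theorem re_diagRel (a b : X) : REPred fun t : List Bool × List X => DiagRel a b t.1 t.2 := by
  classical
  refine PrimrecPred.exists_re (R := fun (t : List Bool × List X) (u : ℕ × ℕ × ℕ) =>
    t.1 = unary u.1 ∧ t.2 = marker a b u.1 ++ List.replicate u.2.1 a ∧
    ∀ j < u.2.1, (evaln u.2.2 (Denumerable.ofNat Code u.1) (Nat.pair u.1 j)).isSome) ?_
  let τ := (List Bool × List X) × (ℕ × ℕ × ℕ)
  have hn : Primrec fun t : τ => t.2.1 := Primrec.fst.comp Primrec.snd
  have hk : Primrec fun t : τ => t.2.2.1 := Primrec.fst.comp (Primrec.snd.comp Primrec.snd)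
  have hm : Primrec fun t : τ => t.2.2.2 := Primrec.snd.comp (Primrec.snd.comp Primrec.snd)
  have h3 : PrimrecRel fun (k : ℕ) (v : ℕ × ℕ) =>
      ∀ j < k, (evaln v.2 (Denumerable.ofNat Code v.1) (Nat.pair v.1 j)).isSome := by
    have h0 : Primrec fun t : ℕ × (ℕ × ℕ) =>
        (evaln t.2.2 (Denumerable.ofNat Code t.2.1) (Nat.pair t.2.1 t.1)).isSome :=
      Primrec.option_isSome.comp (primrec_evaln.comp
        (((Primrec.snd.comp Primrec.snd).pair
          ((Primrec.ofNat Code).comp (Primrec.fst.comp Primrec.snd))).pair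
          (Primrec₂.natPair.comp (Primrec.fst.comp Primrec.snd) Primrec.fst)))
    have h := PrimrecRel.forall_mem_list (R := fun (j : ℕ) (v : ℕ × ℕ) =>
      ((evaln v.2 (Denumerable.ofNat Code v.1) (Nat.pair v.1 j)).isSome : Prop))
      (Primrec.primrecPred (h0.of_eq fun t => by simp))
    exact PrimrecPred.of_eq (h.comp (Primrec.list_range.comp Primrec.fst) Primrec.snd)
      fun t => by simp
  exact (Primrec.eq.comp (Primrec.fst.comp Primrec.fst) (primrec_unary.comp hn)).and
    ((Primrec.eq.comp (Primrec.snd.comp Primrec.fst) (Primrec.list_append.comp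
      ((primrec_marker a b).comp hn) ((primrec_replicate a).comp hk))).and
        (h3.comp hk (hn.pair hm)))

/-- The machine with the instructions `DiagRel a b`. -/
noncomputable def diag (a b : X) : MonotoneMachine X :=
  ofRel (DiagRel a b) (consistent_diagRel a b) (re_diagRel a b)

theorem le_M_of_isInitial {U : MonotoneMachine X} {p : List Bool} {x : List X}
    (h : IsInitial x (U.out p)) : (2⁻¹ : ℝ≥0∞) ^ p.length ≤ U.M x := by
  rw [M_eq_prob, ← coinMeasure_cyl]
  refine MeasureTheory.measure_mono fun ω hω => ⟨p.length, ?_⟩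
  have hp : p = List.ofFn fun i : Fin p.length => ω i := hω
  rwa [← hp]

theorem M_eq_zero {U : MonotoneMachine X} {x : List X} (h : ∀ p, ¬ IsInitial x (U.out p)) :
    U.M x = 0 := by
  have : IsEmpty (U.minimalPrograms x) := ⟨fun p => h _ p.2.1⟩
  simp [M]

theorem exists_forall_evaln_isSome (c : Code) (f : ℕ → ℕ) (N : ℕ)
    (h : ∀ j < N, (eval c (f j)).Dom) : ∃ m, ∀ j < N, (evaln m c (f j)).isSome := by
  induction N with
  | zero => exact ⟨0, by simp⟩
  | succ N ih =>
    obtain ⟨m, hm⟩ := ih fun j hj => h j (by omega)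
    obtain ⟨v, hv⟩ := Part.dom_iff_mem.1 (h N (by omega))
    obtain ⟨m', hm'⟩ := evaln_complete.1 hv
    have mono : ∀ {k : ℕ} (j), k ≤ max m m' → (evaln k c (f j)).isSome →
        (evaln (max m m') c (f j)).isSome := by
      intro k j hk hs
      obtain ⟨w, hw⟩ := Option.isSome_iff_exists.1 hs
      exact Option.isSome_iff_exists.2 ⟨w, Nat.Partrec.Code.evaln_mono hk hw⟩
    refine ⟨max m m', fun j hj => ?_⟩
    rcases Nat.lt_succ_iff_lt_or_eq.1 hj with hj | rfl
    · exact mono j (le_max_left _ _) (hm j hj)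
    · exact mono j (le_max_right _ _) (Option.isSome_iff_exists.2 ⟨v, hm'⟩)

theorem MM_diag_pos_iff [Fintype X] {a b : X} (hab : a ≠ b) (n : ℕ) :
    0 < (diag a b).MM (marker a b n) ↔ n ∈ diagTotal := by
  constructor
  · intro hpos k
    by_contra hk
    -- no output extends `aⁿb` by more than `k` symbols
    refine hpos.not_ge (le_of_tendsto ((diag a b).tendsto_MM _)
      (eventually_atTop.2 ⟨k + 1, fun N hN => ?_⟩))
    refine le_of_eq (Finset.sum_eq_zero fun y _ => M_eq_zero fun p hp => ?_)
    rcases isInitial_ofRel.1 hp with h | ⟨-, -, -, ⟨⟨i, l, m⟩, -, rfl, hl⟩, h⟩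
    · simp [marker] at h
    · obtain ⟨rfl, h⟩ := (marker_append_prefix hab).1 h
      have hlen := h.length_le
      simp only [List.length_ofFn, List.length_replicate] at hlen
      obtain ⟨v, hv⟩ := Option.isSome_iff_exists.1 (hl k (by simpa using (by omega : k < l)))
      exact hk (Part.dom_iff_mem.2 ⟨v, Nat.Partrec.Code.evaln_sound hv⟩)
  · intro hn
    have hle : (2⁻¹ : ℝ≥0∞) ^ (unary n).length ≤ (diag a b).MM (marker a b n) := by
      refine ge_of_tendsto' ((diag a b).tendsto_MM _) fun N => ?_
      refine le_trans ?_ (Finset.single_le_sum (fun _ _ => zero_le)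
        (Finset.mem_univ fun _ : Fin N => a))
      refine le_M_of_isInitial (isInitial_ofRel.2 (Or.inr ⟨_, List.prefix_refl _, _, ?_,
        List.prefix_refl _⟩))
      obtain ⟨m, hm⟩ := exists_forall_evaln_isSome (Denumerable.ofNat Code n) (Nat.pair n) N
        fun j _ => hn j
      exact ⟨(n, N, m), rfl, by simp, hm⟩
    exact lt_of_lt_of_le (by simp [pos_iff_ne_zero]) hle

/-! ### Choosing between two machines by the first input bit -/

/-- The machine that runs `T` or `U` on the remaining input, depending on the first input bit. -/
def branch (T U : MonotoneMachine X) : MonotoneMachine X where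
  out
    | [] => Stream'.Seq.nil
    | false :: p => T.out p
    | true :: p => U.out p
  mono := by
    rintro (- | ⟨_ | _, p⟩) q hpq i a h
    · simp at h
    · obtain ⟨r, rfl⟩ := hpq
      exact T.mono p _ (List.prefix_append _ _) i a h
    · obtain ⟨r, rfl⟩ := hpq
      exact U.mono p _ (List.prefix_append _ _) i a h
  re := by
    have key : ∀ (c : Bool) (V : MonotoneMachine X), REPred fun t : List Bool × List X =>
        ∃ p : List Bool, t.1 = c :: p ∧ IsInitial t.2 (V.out p) := fun c V =>
      REPred.exists (p := fun (t : List Bool × List X) (p : List Bool) =>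
        t.1 = c :: p ∧ IsInitial t.2 (V.out p))
        (REPred.and (Primrec.eq.comp (Primrec.fst.comp Primrec.fst)
          (Primrec.list_cons.comp (Primrec.const c) Primrec.snd)).computablePred.to_re
          (V.re.comp (f := fun t : (List Bool × List X) × List Bool => (t.2, t.1.2))
            (Computable.snd.pair (Computable.snd.comp Computable.fst))))
    have h0 : REPred fun t : List Bool × List X => t.2 = [] := by
      classical
      exact (Primrec.eq.comp Primrec.snd (Primrec.const [])).computablePred.to_re
    refine (h0.or ((key false T).or (key true U))).of_eq ?_
    rintro ⟨- | ⟨_ | _, p⟩, x⟩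
    · rcases x with - | ⟨a, x⟩
      · simpa using isInitial_nil _
      · simp only [reduceCtorEq, false_and, exists_false, or_self, false_iff]
        intro h
        simpa using h 0 (by simp)
    · simp only [List.cons.injEq, true_and, exists_eq_left', false_and, exists_false,
        or_false, Bool.false_eq_true]
      exact or_iff_right_of_imp fun h => h ▸ isInitial_nil _
    · simp only [List.cons.injEq, true_and, exists_eq_left', reduceCtorEq, false_and,
        exists_false, false_or]
      exact or_iff_right_of_imp fun h => h ▸ isInitial_nil _

theorem IsUniversal.branch {U : MonotoneMachine X} (hU : U.IsUniversal)
    (T : MonotoneMachine X) : (T.branch U).IsUniversal := by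
  intro V
  obtain ⟨w, hw⟩ := hU V
  exact ⟨true :: w, hw⟩

theorem minimalPrograms_branch (T U : MonotoneMachine X) {x : List X} (hx : x ≠ []) :
    (T.branch U).minimalPrograms x =
      List.cons false '' T.minimalPrograms x ∪ List.cons true '' U.minimalPrograms x := by
  have hnil : ¬ IsInitial x ((T.branch U).out []) := by
    obtain ⟨a, x, rfl⟩ := List.exists_cons_of_ne_nil hx
    intro h
    simpa [MonotoneMachine.branch] using h 0 (by simp)
  have key : ∀ c p, c :: p ∈ (T.branch U).minimalPrograms x ↔
      p ∈ (cond c U T).minimalPrograms x := by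
    intro c p
    have hout : ∀ q, (T.branch U).out (c :: q) = (cond c U T).out q := by
      intro q
      cases c <;> rfl
    simp only [minimalPrograms, Set.mem_ofPred_eq, hout]
    refine and_congr_right fun _ => ⟨fun h q hq hxq => ?_, fun h q hq hxq => ?_⟩
    · simpa using h (c :: q) (by simpa using hq) (by rwa [hout])
    · rcases q with - | ⟨d, q⟩
      · exact absurd hxq hnil
      · obtain ⟨rfl, hqp⟩ := List.cons_prefix_cons.1 hq
        rw [h q hqp (by rwa [← hout])]
  ext p
  rcases p with - | ⟨_ | _, p⟩
  · simpa [minimalPrograms] using fun h => absurd h hnil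
  · simp [key]
  · simp [key]

theorem M_branch (T U : MonotoneMachine X) {x : List X} (hx : x ≠ []) :
    (T.branch U).M x = 2⁻¹ * (T.M x + U.M x) := by
  have hcons : ∀ (c : Bool) (A : Set (List Bool)),
      ∑' p : (List.cons c '' A : Set (List Bool)), (2⁻¹ : ℝ≥0∞) ^ (p : List Bool).length =
        2⁻¹ * ∑' p : A, (2⁻¹ : ℝ≥0∞) ^ (p : List Bool).length := by
    intro c A
    rw [tsum_image (fun p : List Bool => (2⁻¹ : ℝ≥0∞) ^ p.length) (List.cons_injective).injOn,
      ← ENNReal.tsum_mul_left]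
    simp only [List.length_cons, pow_succ']
  rw [M, minimalPrograms_branch T U hx,
    Summable.tsum_union_disjoint (f := fun p : List Bool => (2⁻¹ : ℝ≥0∞) ^ p.length) ?_
      ENNReal.summable ENNReal.summable, hcons, hcons, mul_add]
  · rfl
  · rw [Set.disjoint_left]
    rintro _ ⟨p, -, rfl⟩ ⟨q, -, h⟩
    simp at h

theorem MM_branch [Fintype X] (T U : MonotoneMachine X) (x : List X) :
    (T.branch U).MM x = 2⁻¹ * (T.MM x + U.MM x) := by
  refine tendsto_nhds_unique ((T.branch U).tendsto_MM x) ?_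
  refine (ENNReal.Tendsto.const_mul ((T.tendsto_MM x).add (U.tendsto_MM x))
    (Or.inr (by simp))).congr' ?_
  filter_upwards [eventually_ge_atTop 1] with n hn
  rw [← Finset.sum_add_distrib, Finset.mul_sum]
  refine Finset.sum_congr rfl fun y _ => (M_branch T U fun h => ?_).symm
  have := congrArg List.length h
  simp at this
  omega

/-! ### The strict subgraph of the measure mixture -/

/-- The pairs of a string `x` and a code of a rational number `q` such that `q < M̄_U(x)`. -/
def subgraph [Fintype X] (U : MonotoneMachine X) : Set (List X × (ℤ × ℕ)) :=
  {t | ((ratOfCode t.2 : ℚ) : ℝ) < (U.MM t.1).toReal}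

theorem primrec_intOfNat : Primrec (Int.ofNat) := by
  refine Primrec.encode_iff.1 (Primrec.nat_double.of_eq fun n => ?_)
  rfl

/-- Since `M̄` of the branching machine is the mean of those of `T` and `U`, it exceeds half of
`M̄_U(x)` exactly if `M̄_T(x)` is positive. This is expressed by a nonnegative rational number
`m/(d+1)` in the half-open gap, so that both conditions concern the subgraphs only. -/
theorem exists_ratOfCode_between [Fintype X] {T U : MonotoneMachine X} {x : List X} :
    0 < T.MM x ↔ ∃ m d : ℕ, (x, Int.ofNat m, d) ∈ (T.branch U).subgraph ∧
      (x, Int.ofNat (2 * m), d) ∉ U.subgraph := by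
  have hT : T.MM x ≠ ∞ := ((T.MM_le_one x).trans_lt ENNReal.one_lt_top).ne
  have hU : U.MM x ≠ ∞ := ((U.MM_le_one x).trans_lt ENNReal.one_lt_top).ne
  have hB : ((T.branch U).MM x).toReal = ((T.MM x).toReal + (U.MM x).toReal) / 2 := by
    rw [MM_branch, ENNReal.toReal_mul, ENNReal.toReal_add hT hU]
    simp only [ENNReal.toReal_inv, ENNReal.toReal_ofNat]
    ring
  have hpos : 0 < T.MM x ↔ 0 < (T.MM x).toReal := by
    rw [ENNReal.toReal_pos_iff]
    exact ⟨fun h => ⟨h, hT.lt_top⟩, fun h => h.1⟩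
  have hdouble : ∀ m d : ℕ, ((ratOfCode (Int.ofNat (2 * m), d) : ℚ) : ℝ) =
      2 * ((ratOfCode (Int.ofNat m, d) : ℚ) : ℝ) := by
    intro m d
    simp only [ratOfCode, Int.ofNat_eq_natCast]
    push_cast
    ring
  simp only [subgraph, Set.mem_ofPred_eq, hB, hdouble, not_lt, hpos]
  constructor
  · intro h
    obtain ⟨q, hq, hq'⟩ := exists_rat_btwn (show (U.MM x).toReal / 2 <
      ((T.MM x).toReal + (U.MM x).toReal) / 2 by linarith)
    obtain ⟨⟨m, d⟩, rfl⟩ := ratOfCode_surjective q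
    have hm : 0 ≤ m := by
      have h0 : (0 : ℝ) < (ratOfCode (m, d) : ℚ) :=
        lt_of_le_of_lt (div_nonneg ENNReal.toReal_nonneg zero_le_two) hq
      have h1 : (0 : ℚ) < (m : ℚ) / ((d : ℚ) + 1) := Rat.cast_pos.1 h0
      have h2 : (0 : ℚ) < m := (div_pos_iff_of_pos_right (by positivity)).1 h1
      exact_mod_cast h2.le
    lift m to ℕ using hm
    exact ⟨m, d, hq', by change _ ≤ 2 * ((ratOfCode ((m : ℤ), d) : ℚ) : ℝ); linarith⟩
  · rintro ⟨m, d, h, h'⟩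
    linarith

/-- If both sets were in the stated classes, then `diagTotal`, which is
`{n | 0 < M̄_T(aⁿb)}` for `T = diag a b`, would be `Σ⁰₂`. -/
theorem not_isSigma02_or_not_isPi02 [Fintype X] {a b : X} (hab : a ≠ b)
    (U : MonotoneMachine X) :
    ¬ IsSigma02 ((diag a b).branch U).subgraph ∨ ¬ IsPi02 U.subgraph := by
  by_contra h
  push Not at h
  obtain ⟨h1, h2⟩ := h
  have hu : Computable fun t : ℕ × ℕ => t.2.unpair := Computable.unpair.comp Computable.snd
  have hx : Computable fun t : ℕ × ℕ => marker a b t.1 :=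
    (primrec_marker a b).to_comp.comp Computable.fst
  have hf : Computable fun t : ℕ × ℕ =>
      (marker a b t.1, Int.ofNat t.2.unpair.1, t.2.unpair.2) :=
    hx.pair ((primrec_intOfNat.to_comp.comp (Computable.fst.comp hu)).pair
      (Computable.snd.comp hu))
  have hg : Computable fun t : ℕ × ℕ =>
      (marker a b t.1, Int.ofNat (2 * t.2.unpair.1), t.2.unpair.2) :=
    hx.pair ((primrec_intOfNat.to_comp.comp (Primrec.nat_double.to_comp.comp
      (Computable.fst.comp hu))).pair (Computable.snd.comp hu))
  have h3 := IsSigma02.exists_nat (P := fun n k =>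
    (marker a b n, Int.ofNat k.unpair.1, k.unpair.2) ∈ ((diag a b).branch U).subgraph ∧
      (marker a b n, Int.ofNat (2 * k.unpair.1), k.unpair.2) ∉ U.subgraph)
    ((h1.preimage hf).inter (h2.preimage hg))
  refine not_isSigma02_diagTotal ?_
  convert! h3 using 1
  ext n
  rw [← MM_diag_pos_iff hab, exists_ratOfCode_between (U := U)]
  constructor
  · rintro ⟨m, d, h⟩
    exact ⟨Nat.pair m d, by simpa using h⟩
  · rintro ⟨k, h⟩
    exact ⟨_, _, h⟩

end MonotoneMachine

theorem theorem2 (X : Type*) [Fintype X] [Nontrivial X] [Primcodable X] :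
    ∃ U : MonotoneMachine X, U.IsUniversal ∧
      ¬ IsDelta02 {t : List X × (ℤ × ℕ) |
        ((ratOfCode t.2 : ℚ) : ℝ) < (U.MM t.1).toReal} := by
  obtain ⟨a, b, hab⟩ := exists_pair_ne X
  have hU : (MonotoneMachine.universal X).IsUniversal := MonotoneMachine.isUniversal_universal
  rcases MonotoneMachine.not_isSigma02_or_not_isPi02 hab (.universal X) with h | h
  · exact ⟨_, hU.branch (.diag a b), fun hd => h hd.1⟩
  · exact ⟨_, hU, fun hd => h hd.2⟩
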